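/- Let $K$ be a field with $\operatorname{char} K \neq 2$. For a finite-dimensional unital (not necessarily associative) $K$-algebra $B$ with a scalar involution $\overline{\phantom{x}}$ (so $a+\overline a,\ a\overline a\in K\cdot 1$) and $\gamma\in K\setminus\{0\}$, the Cayley–Dickson process produces the algebra $(B,\gamma)=B\oplus B$ with multiplication $$(a_1,a_2)(b_1,b_2)=\bigl(a_1b_1+\gamma\,\overline{b_2}\,a_2,\ a_2\overline{b_1}+b_2a_1\bigr)$$ and scalar involution $\overline{(a_1,a_2)}=(\overline{a_1},-a_2)$. Let $A$ be an algebra of dimension $2^t$ obtained from $K$ (with the identity as involution) by applying this process $t$ times, with nonzero parameters $\alpha_1,\dots,\alpha_t\in K$. Let $t(x)\in K$ be the trace of $x\in A$, $t(x)\cdot 1=x+\overline x$. Let $T_C(x)=\tfrac12 t(x^2)$ be the trace form of $A$, let $A_0=\{x\in A: t(x)=0\}$ be the space of pure elements, and let $T_P=T_C|_{A_0}$ be the pure trace form. The sublevel $\underline{s}(A)$ is the least integer $n$ such that $0$ is a sum of $n+1$ nonzero squares of elements of $A$ ($\infty$ if there is no such $n$). A quadratic form is isotropic if it vanishes at some nonzero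 vector, and $n\times T_P$ denotes the orthogonal sum of $n$ copies of $T_P$. **Proposition 3.5.** If $t\ge 2$ and $k>1$, then $$\underline{s}(A)\le 2^k-1\quad\Longleftrightarrow\quad \langle 1\rangle\perp(2^k-1)\times T_P\ \text{ is isotropic over } K.$$ -/

import Mathlib

universe u

/-- A unital, not necessarily associative `K`-algebra with a scalar involution `star`, together with
its trace `t` and its norm `n`, given by `t(a)·1 = a + ā` and `n(a)·1 = a ā`. -/
structure ScalarInvolutionAlgebra (K : Type u) [Field K] where
  carrier : Type u
  [ring : NonAssocRing carrier]
  [module : Module K carrier]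
  [isScalarTower : IsScalarTower K carrier carrier]
  [smulCommClass : SMulCommClass K carrier carrier]
  [starRing : StarRing carrier]
  star_smul' : ∀ (c : K) (a : carrier), star (c • a) = c • star a
  trace : carrier →ₗ[K] K
  norm : carrier → K
  trace_smul_one : ∀ a : carrier, trace a • (1 : carrier) = a + star a
  norm_smul_one : ∀ a : carrier, norm a • (1 : carrier) = a * star a

namespace ScalarInvolutionAlgebra

variable {K : Type u} [Field K]

instance : CoeSort (ScalarInvolutionAlgebra K) (Type u) := ⟨carrier⟩

attribute [instance] ring module isScalarTower smulCommClass starRing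

theorem star_mul_self_eq (A : ScalarInvolutionAlgebra K) (a : A) : star a * a = a * star a := by
  have h : star a = A.trace a • (1 : A) - a := by rw [A.trace_smul_one]; abel
  rw [h, sub_mul, mul_sub, smul_mul_assoc, mul_smul_comm, one_mul, mul_one]

/-- The quadratic equation `x² = t(x) x - n(x)`. -/
theorem mul_self_eq (A : ScalarInvolutionAlgebra K) (a : A) :
    a * a = A.trace a • a - A.norm a • (1 : A) := by
  have h : star a = A.trace a • (1 : A) - a := by rw [A.trace_smul_one]; abel
  rw [A.norm_smul_one, h, mul_sub, mul_smul_comm, mul_one]; abel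

/-- The field `K` with the identity as involution. -/
def base (K : Type u) [Field K] : ScalarInvolutionAlgebra K :=
  letI : StarRing K := starRingOfComm
  { carrier := K
    star_smul' := fun _ _ => rfl
    trace := (2 : K) • LinearMap.id
    norm := fun a => a * a
    trace_smul_one := fun a => by
      change ((2 : K) * a) * 1 = a + a
      ring
    norm_smul_one := fun a => by
      change (a * a) * 1 = a * a
      ring }

/-- The vector space `A ⊕ A` underlying the Cayley–Dickson double `(A, γ)`. -/
def Double (A : ScalarInvolutionAlgebra K) (_γ : K) : Type u := A × A

namespace Double

variable {A : ScalarInvolutionAlgebra K} {γ : K}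

instance instAddCommGroup : AddCommGroup (Double A γ) := inferInstanceAs (AddCommGroup (A × A))

instance instSMul : SMul K (Double A γ) := ⟨fun c x => (c • x.1, c • x.2)⟩

/-- `(a₁, a₂)(b₁, b₂) = (a₁b₁ + γ b̄₂a₂, a₂b̄₁ + b₂a₁)`. -/
instance instMul : Mul (Double A γ) :=
  ⟨fun x y => (x.1 * y.1 + γ • (star y.2 * x.2), x.2 * star y.1 + y.2 * x.1)⟩

instance instOne : One (Double A γ) := ⟨((1 : A), (0 : A))⟩

/-- The conjugate of `(a₁, a₂)` is `(ā₁, -a₂)`. -/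
instance : Star (Double A γ) := ⟨fun x => (star x.1, -x.2)⟩

@[ext] theorem ext {x y : Double A γ} (h₁ : x.1 = y.1) (h₂ : x.2 = y.2) : x = y := Prod.ext h₁ h₂

@[simp] theorem zero_fst : (0 : Double A γ).1 = 0 := rfl
@[simp] theorem zero_snd : (0 : Double A γ).2 = 0 := rfl
@[simp] theorem one_fst : (1 : Double A γ).1 = 1 := rfl
@[simp] theorem one_snd : (1 : Double A γ).2 = 0 := rfl
@[simp] theorem add_fst (x y : Double A γ) : (x + y).1 = x.1 + y.1 := rfl
@[simp] theorem add_snd (x y : Double A γ) : (x + y).2 = x.2 + y.2 := rfl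
@[simp] theorem smul_fst (c : K) (x : Double A γ) : (c • x).1 = c • x.1 := rfl
@[simp] theorem smul_snd (c : K) (x : Double A γ) : (c • x).2 = c • x.2 := rfl
@[simp] theorem star_fst (x : Double A γ) : (star x).1 = star x.1 := rfl
@[simp] theorem star_snd (x : Double A γ) : (star x).2 = -x.2 := rfl
@[simp] theorem mul_fst (x y : Double A γ) :
    (x * y).1 = x.1 * y.1 + γ • (star y.2 * x.2) := rfl
@[simp] theorem mul_snd (x y : Double A γ) :
    (x * y).2 = x.2 * star y.1 + y.2 * x.1 := rfl

instance instNonAssocRing : NonAssocRing (Double A γ) :=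
  { instAddCommGroup, instMul, instOne with
    left_distrib := fun x y z => by
      ext <;> simp [mul_add, add_mul, smul_add] <;> abel
    right_distrib := fun x y z => by
      ext <;> simp [mul_add, add_mul, smul_add] <;> abel
    zero_mul := fun x => by ext <;> simp
    mul_zero := fun x => by ext <;> simp
    one_mul := fun x => by ext <;> simp
    mul_one := fun x => by ext <;> simp }

instance instModule : Module K (Double A γ) where
  one_smul := fun x => by ext <;> simp
  mul_smul := fun c d x => by ext <;> simp [mul_smul]
  smul_zero := fun c => by ext <;> simp
  smul_add := fun c x y => by ext <;> simp
  add_smul := fun c d x => by ext <;> simp [add_smul]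
  zero_smul := fun x => by ext <;> simp

instance : IsScalarTower K (Double A γ) (Double A γ) :=
  ⟨fun c x y => by
    ext <;> simp [smul_add, smul_mul_assoc, mul_smul_comm, smul_comm c γ]⟩

instance : SMulCommClass K (Double A γ) (Double A γ) :=
  ⟨fun c x y => by
    ext <;> simp [smul_add, smul_mul_assoc, mul_smul_comm, A.star_smul', smul_comm c γ]⟩

instance : StarRing (Double A γ) where
  star_involutive := fun x => by ext <;> simp
  star_mul := fun x y => by
    ext
    · simp [A.star_smul']
    · simp [add_comm]
  star_add := fun x y => by ext <;> simp [add_comm]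

end Double

/-- The Cayley–Dickson process: the algebra `(A, γ)`, with `t(a₁, a₂) = t(a₁)` and
`n(a₁, a₂) = n(a₁) - γ n(a₂)`. -/
def double (A : ScalarInvolutionAlgebra K) (γ : K) : ScalarInvolutionAlgebra K where
  carrier := Double A γ
  star_smul' := fun c x => by ext <;> simp [A.star_smul']
  trace :=
    { toFun := fun x => A.trace x.1
      map_add' := fun x y => map_add A.trace x.1 y.1
      map_smul' := fun c x => map_smul A.trace c x.1 }
  norm := fun x => A.norm x.1 - γ * A.norm x.2
  trace_smul_one := fun x => by
    change A.trace x.1 • (1 : Double A γ) = x + star x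
    ext
    · simp [A.trace_smul_one]
    · simp
  norm_smul_one := fun x => by
    ext
    · change (A.norm x.1 - γ * A.norm x.2) • (1 : A) = x.1 * star x.1 + γ • (star (-x.2) * x.2)
      rw [sub_smul, mul_smul, A.norm_smul_one, A.norm_smul_one, star_neg, neg_mul, smul_neg,
        A.star_mul_self_eq, sub_eq_add_neg]
    · simp

/-- The algebra `A_t = K{α₁, …, α_t}`, obtained from `K` by applying the Cayley–Dickson process `t`
times, with the parameters `α₁, …, α_t` in this order. -/
def cayleyDickson : (t : ℕ) → (Fin t → K) → ScalarInvolutionAlgebra K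
  | 0, _ => base K
  | t + 1, α => double (cayleyDickson t (fun i => α i.castSucc)) (α (Fin.last t))

/-- The trace form `T_C(x) = t(x²) / 2`, that is, the scalar part of `x²` (for `char K ≠ 2`). -/
def traceForm (A : ScalarInvolutionAlgebra K) : QuadraticForm K A :=
  LinearMap.BilinMap.toQuadraticMap
    ((LinearMap.mul K A).compr₂ ((2 : K)⁻¹ • A.trace))

/-- The space `A₀` of pure elements: the elements whose scalar part `t(x) / 2` vanishes. -/
def pure (A : ScalarInvolutionAlgebra K) : Submodule K A := LinearMap.ker A.trace

/-- In characteristic not two, `A₀` consists of `0` and of the `x ∉ K·1` with `x² ∈ K·1`. -/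
theorem mem_pure_iff (A : ScalarInvolutionAlgebra K) (h2 : (2 : K) ≠ 0) (x : A) :
    x ∈ A.pure ↔ x = 0 ∨
      ((¬ ∃ c : K, x = c • (1 : A)) ∧ ∃ c : K, x * x = c • (1 : A)) := by
  change A.trace x = 0 ↔ _
  have hq := A.mul_self_eq x
  constructor
  · intro h
    by_cases hx : x = 0
    · exact Or.inl hx
    · refine Or.inr ⟨?_, -A.norm x, by rw [hq, h]; simp⟩
      rintro ⟨c, rfl⟩
      have h1 := A.trace_smul_one (c • (1 : A))
      rw [h, zero_smul, A.star_smul', star_one, ← two_smul K, smul_smul] at h1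
      rcases eq_or_ne c 0 with hc | hc
      · exact hx (by rw [hc, zero_smul])
      · refine hx ?_
        have h3 := congrArg (fun y => ((2 : K)⁻¹) • y) h1
        simp only [smul_zero, smul_smul] at h3
        rw [inv_mul_cancel_left₀ h2] at h3
        exact h3.symm
  · rintro (rfl | ⟨h1, c, hc⟩)
    · exact map_zero _
    · by_contra ht
      apply h1
      refine ⟨(A.trace x)⁻¹ * (c + A.norm x), ?_⟩
      rw [mul_smul, add_smul, ← hc, hq, sub_add_cancel, smul_smul, inv_mul_cancel₀ ht, one_smul]

/-- The pure trace form `T_P`: the restriction of `T_C` to `A₀`. -/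
def pureTraceForm (A : ScalarInvolutionAlgebra K) : QuadraticForm K A.pure :=
  A.traceForm.comp A.pure.subtype

end ScalarInvolutionAlgebra

/-- The sublevel of `A`: the least `n` such that `0` is a sum of `n + 1` nonzero squares of elements
of `A`, and `⊤` if there is no such `n`. -/
noncomputable def sublevel (A : Type*) [NonAssocRing A] : ℕ∞ :=
  ⨅ (n : ℕ) (_ : ∃ y : Fin (n + 1) → A, (∀ i, y i * y i ≠ 0) ∧ ∑ i, y i * y i = 0), (n : ℕ∞)

/-- A quadratic form is isotropic if it vanishes at some nonzero vector. -/
def QuadraticForm.IsIsotropic {K V : Type*} [Field K] [AddCommGroup V] [Module K V]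
    (Q : QuadraticForm K V) : Prop :=
  ∃ v : V, v ≠ 0 ∧ Q v = 0

/-- The quadratic form `⟨1⟩ ⊥ n × Q`, where `n × Q = Q ⊥ ⋯ ⊥ Q` (`n` copies). -/
def QuadraticForm.onePerpCopies {K V : Type*} [Field K] [AddCommGroup V] [Module K V]
    (n : ℕ) (Q : QuadraticForm K V) : QuadraticForm K (K × (Fin n → V)) :=
  QuadraticMap.prod (QuadraticMap.sq (R := K)) (QuadraticMap.pi fun _ : Fin n => Q)

/-! Write `yᵢ = aᵢ + uᵢ` with `aᵢ` scalar and `uᵢ` pure. Since `uᵢ² = T_P(uᵢ)·1`, the equation `∑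
yᵢ² = 0` means `∑ aᵢ uᵢ = 0` and `s + ∑ T_P(uᵢ) = 0`, where `s = ∑ aᵢ²`. There are `2 ^ k` terms. If
`s ≠ 0`, some matrix `M` with `Mᵀ M = s` has first row `±a`. Applied to the family `u`, it
multiplies `∑ T_P(uᵢ)` by `s` and kills the first entry, so `(2 ^ k - 1) × T_P` takes the value `s ∑
T_P(uᵢ) = -s²`, and `⟨1⟩ ⊥ (2 ^ k - 1) × T_P` vanishes at a vector with first coordinate `s`. If `s
= 0`, one of the Pfister forms `2 ^ k × ⟨1⟩` (when `a ≠ 0`) and `2 ^ k × n` (when `a = 0`, as `T_P =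
-n` on pure elements) is isotropic. It then has a totally isotropic subspace of half the dimension,
large enough to contain a nonzero vector satisfying the linear conditions that make `(2 ^ k - 1) ×
T_P` isotropic. Conversely, an isotropic vector `(a, v)` gives `(a·1)² + ∑ vᵢ² = 0`. This is trivial
only if every square is zero; then `T_P` is isotropic, hence represents `-1` by nondegeneracy, and
`1² + w² = 0`. Both Pfister properties are carried through `Q ⊥ d Q` by `IsPfisterLike.prod_smul`,
which covers doubling the number of copies as well as the Cayley–Dickson step. -/

namespace QuadraticForm

/-! ### Roundness and Lagrangians of Pfister-type forms -/

variable {K V W : Type*} [Field K] [AddCommGroup V] [Module K V] [AddCommGroup W] [Module K W]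

/-- `Q` has a totally isotropic subspace of at least half the dimension. -/
def HasLagrangian (Q : QuadraticForm K V) : Prop :=
  ∃ U : Submodule K V, (∀ x ∈ U, Q x = 0) ∧
    Module.finrank K V ≤ 2 * Module.finrank K U

/-- Every nonzero value of `Q` is a similarity factor of `Q`. -/
def IsRound (Q : QuadraticForm K V) : Prop :=
  ∀ z, Q z ≠ 0 → ∃ S : V ≃ₗ[K] V, ∀ x, Q (S x) = Q z * Q x

/-- The two basic properties of Pfister forms: roundness, and hyperbolicity in the isotropic
case. -/
structure IsPfisterLike (Q : QuadraticForm K V) : Prop where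
  round : IsRound Q
  hasLagrangian : Q.IsIsotropic → HasLagrangian Q

theorem isPfisterLike_sq : IsPfisterLike (QuadraticMap.sq (R := K)) where
  round z hz := by
    have hz' : z ≠ 0 := by rintro rfl; simp at hz
    refine ⟨LinearEquiv.smulOfNeZero K K z hz', fun x => ?_⟩
    simp [QuadraticMap.sq]
    ring
  hasLagrangian := by
    rintro ⟨v, hv, h⟩
    simp [QuadraticMap.sq, hv] at h

theorem IsPfisterLike.of_equivalent {Q : QuadraticForm K V} {Q' : QuadraticForm K W}
    (h : IsPfisterLike Q) (e : Q.IsometryEquiv Q') : IsPfisterLike Q' where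
  round z hz := by
    obtain ⟨S, hS⟩ := h.round (e.symm z) (by rwa [e.symm.map_app])
    refine ⟨e.symm.toLinearEquiv.trans (S.trans e.toLinearEquiv), fun x => ?_⟩
    change Q' (e (S (e.symm x))) = _
    rw [e.map_app, hS, e.symm.map_app, e.symm.map_app]
  hasLagrangian := by
    rintro ⟨v, hv, hQ⟩
    obtain ⟨U, hU, hd⟩ := h.hasLagrangian
      ⟨e.symm v, fun h0 => hv (e.symm.toLinearEquiv.map_eq_zero_iff.1 h0), by
        rw [e.symm.map_app, hQ]⟩
    refine ⟨U.map (e.toLinearEquiv : V →ₗ[K] W), ?_, ?_⟩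
    · rintro _ ⟨x, hx, rfl⟩
      exact (e.map_app x).trans (hU x hx)
    · rw [← e.toLinearEquiv.finrank_eq, LinearEquiv.finrank_map_eq]
      exact hd

/-- When `Q x` and `Q y` are nonzero, `e = d Q(y) / Q(x)` makes `Q ⊥ d Q` isometric to `Q ⊥ e Q`.
The latter has the explicit similarity `(u, w) ↦ (u - e w, u + w)` of factor `1 + e`, and `Q(x) (1 +
e) = Q(x) + d Q(y)`. -/
theorem IsRound.prod_smul {Q : QuadraticForm K V} (h : IsRound Q) {d : K} (hd : d ≠ 0) :
    IsRound (QuadraticMap.prod Q (d • Q)) := by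
  rintro ⟨x, y⟩ hz
  simp only [QuadraticMap.prod_apply, _root_.smul_apply, smul_eq_mul] at hz ⊢
  rcases eq_or_ne (Q y) 0 with hy | hy
  · rw [hy, mul_zero, add_zero] at hz
    obtain ⟨S, hS⟩ := h x hz
    refine ⟨S.prodCongr S, fun v => ?_⟩
    simp only [LinearEquiv.prodCongr_apply, hS, hy]
    ring
  obtain ⟨B, hB⟩ := h y hy
  rcases eq_or_ne (Q x) 0 with hx | hx
  -- The value is `d Q(y)`: the swap `(v₁, v₂) ↦ (d v₂, v₁)` contributes the factor `d`, and `B`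
  -- contributes `Q(y)`.
  · refine ⟨(LinearEquiv.prodComm K V V).trans
      ((B.trans (LinearEquiv.smulOfNeZero K V d hd)).prodCongr B), fun v => ?_⟩
    simp [hB, hx, QuadraticMap.map_smul]
    ring
  obtain ⟨A, hA⟩ := h x hx
  have hBs : ∀ v, Q (B.symm v) = (Q y)⁻¹ * Q v := fun v => by
    rw [eq_inv_mul_iff_mul_eq₀ hy, ← hB, B.apply_symm_apply]
  set e : K := d * (Q y / Q x) with he
  have h1e : 1 + e ≠ 0 := by
    intro h0
    apply hz
    have : Q x + d * Q y = Q x * (1 + e) := by rw [he]; field_simp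
    rw [this, h0, mul_zero]
  let T : (V × V) →ₗ[K] (V × V) :=
    (LinearMap.fst K V V - e • LinearMap.snd K V V).prod (LinearMap.fst K V V + LinearMap.snd K V V)
  let T' : (V × V) →ₗ[K] (V × V) :=
    ((1 + e)⁻¹ • (LinearMap.fst K V V + e • LinearMap.snd K V V)).prod
      ((1 + e)⁻¹ • (LinearMap.snd K V V - LinearMap.fst K V V))
  have hTT' : T.comp T' = LinearMap.id := by
    refine LinearMap.ext fun v => Prod.ext ?_ ?_
    · change (1 + e)⁻¹ • (v.1 + e • v.2) - e • (1 + e)⁻¹ • (v.2 - v.1) = v.1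
      rw [smul_comm e, ← smul_sub, inv_smul_eq_iff₀ h1e]
      module
    · change (1 + e)⁻¹ • (v.1 + e • v.2) + (1 + e)⁻¹ • (v.2 - v.1) = v.2
      rw [← smul_add, inv_smul_eq_iff₀ h1e]
      module
  have hT'T : T'.comp T = LinearMap.id := by
    refine LinearMap.ext fun v => Prod.ext ?_ ?_
    · change (1 + e)⁻¹ • ((v.1 - e • v.2) + e • (v.1 + v.2)) = v.1
      rw [inv_smul_eq_iff₀ h1e]
      module
    · change (1 + e)⁻¹ • ((v.1 + v.2) - (v.1 - e • v.2)) = v.2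
      rw [inv_smul_eq_iff₀ h1e]
      module
  have hT : ∀ u w, Q (u - e • w) + e * Q (u + w) = (1 + e) * (Q u + e * Q w) := fun u w => by
    have h1 : Q (u - e • w) = Q u + e * e * Q w - e * QuadraticMap.polar Q u w := by
      rw [sub_eq_add_neg, ← neg_smul, QuadraticMap.map_add Q, QuadraticMap.map_smul,
        QuadraticMap.polar_smul_right, smul_eq_mul, smul_eq_mul]
      ring
    rw [h1, QuadraticMap.map_add Q]
    ring
  let E : (V × V) ≃ₗ[K] V × V := LinearEquiv.ofLinearMap T T' hTT' hT'T
  -- Isometry `Q ⊥ d Q → Q ⊥ e Q`, then the similarity of factor `1 + e`, then `A × B`, which maps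
  -- `Q ⊥ e Q` to `Q ⊥ d Q` with factor `Q(x)`.
  refine ⟨((LinearEquiv.refl K V).prodCongr (B.symm.trans A)).trans (E.trans (A.prodCongr B)),
    fun v => ?_⟩
  change Q (A (v.1 - e • A (B.symm v.2))) + d * Q (B (v.1 + A (B.symm v.2))) = _
  have h2 := hT v.1 (A (B.symm v.2))
  rw [hA, hBs] at h2
  rw [hA, hB]
  calc _ = Q x * (Q (v.1 - e • A (B.symm v.2)) + e * Q (v.1 + A (B.symm v.2))) := by
        rw [he]; field_simp
    _ = _ := by rw [h2, he]; field_simp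

theorem finrank_submodule_prod [FiniteDimensional K V] [FiniteDimensional K W]
    (U : Submodule K V) (U' : Submodule K W) :
    Module.finrank K (U.prod U') = Module.finrank K U + Module.finrank K U' := by
  have hr : U.prod U' = LinearMap.range (U.subtype.prodMap U'.subtype) := by
    rw [LinearMap.range_prodMap, Submodule.range_subtype, Submodule.range_subtype]
  rw [← Module.finrank_prod, hr]
  refine LinearMap.finrank_range_of_inj ?_
  exact Function.Injective.prodMap U.injective_subtype U'.injective_subtype

/-- If `Q(x) = -d Q(y) ≠ 0`, roundness yields a similarity of `Q` of factor `Q(x) / Q(y) = -d`, and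
its graph is a Lagrangian. Otherwise `Q` itself is isotropic and a Lagrangian `U` of `Q` gives `U ×
U`. -/
theorem IsPfisterLike.prod_smul [FiniteDimensional K V] {Q : QuadraticForm K V}
    (h : IsPfisterLike Q) {d : K} (hd : d ≠ 0) :
    IsPfisterLike (QuadraticMap.prod Q (d • Q)) where
  round := h.round.prod_smul hd
  hasLagrangian := by
    rintro ⟨⟨x, y⟩, hv, hQ⟩
    simp only [QuadraticMap.prod_apply, _root_.smul_apply, smul_eq_mul] at hQ
    rcases eq_or_ne (Q y) 0 with hy | hy
    · rw [hy, mul_zero, add_zero] at hQ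
      have hi : Q.IsIsotropic := by
        rcases eq_or_ne x 0 with rfl | hx
        · exact ⟨y, fun h0 => hv (by rw [h0]; rfl), hy⟩
        · exact ⟨x, hx, hQ⟩
      obtain ⟨U, hU, hdim⟩ := h.hasLagrangian hi
      refine ⟨U.prod U, ?_, ?_⟩
      · rintro ⟨a, b⟩ ⟨ha, hb⟩
        simp [hU a ha, hU b hb]
      · rw [finrank_submodule_prod, Module.finrank_prod]
        omega
    · have hx : Q x ≠ 0 := by
        intro h0
        rw [h0, zero_add] at hQ
        exact mul_ne_zero hd hy hQ
      obtain ⟨A, hA⟩ := h.round x hx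
      obtain ⟨B, hB⟩ := h.round y hy
      let T : V →ₗ[K] V × V := ((B.symm.trans A : V ≃ₗ[K] V) : V →ₗ[K] V).prod LinearMap.id
      have hT : Function.Injective T := fun a b hab => congrArg Prod.snd hab
      refine ⟨LinearMap.range T, ?_, ?_⟩
      · rintro _ ⟨v, rfl⟩
        change Q (A (B.symm v)) + d * Q v = 0
        have hv' : Q v = Q y * Q (B.symm v) := by rw [← hB, B.apply_symm_apply]
        rw [hA, hv']
        linear_combination Q (B.symm v) * hQ
      · rw [LinearMap.finrank_range_of_inj hT, Module.finrank_prod]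
        omega

/-- The isometry `(n × Q) ⊥ (n × Q) ≅ (n + n) × Q`. -/
def piAddIsometryEquiv (n : ℕ) (Q : QuadraticForm K V) :
    (QuadraticMap.prod (QuadraticMap.pi fun _ : Fin n => Q)
      ((1 : K) • QuadraticMap.pi fun _ : Fin n => Q)).IsometryEquiv
      (QuadraticMap.pi fun _ : Fin (n + n) => Q) where
  toLinearEquiv := (LinearEquiv.sumArrowLequivProdArrow (Fin n) (Fin n) K V).symm.trans
    (LinearEquiv.funCongrLeft K V finSumFinEquiv.symm)
  map_app' := fun v => by
    change QuadraticMap.pi (fun _ : Fin (n + n) => Q)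
      ((LinearEquiv.funCongrLeft K V finSumFinEquiv.symm)
        ((LinearEquiv.sumArrowLequivProdArrow (Fin n) (Fin n) K V).symm v)) = _
    simp only [QuadraticMap.pi_apply, QuadraticMap.prod_apply, one_smul, LinearEquiv.funCongrLeft_apply,
      LinearMap.funLeft_apply]
    rw [← finSumFinEquiv.sum_comp]
    simp only [Fintype.sum_sum_type, Equiv.symm_apply_apply]
    rfl

theorem IsPfisterLike.pi_two_pow [FiniteDimensional K V] {Q : QuadraticForm K V}
    (h : IsPfisterLike Q) (k : ℕ) :
    IsPfisterLike (QuadraticMap.pi fun _ : Fin (2 ^ k) => Q) := by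
  induction k with
  | zero =>
    refine h.of_equivalent ⟨(LinearEquiv.funUnique (Fin 1) K V).symm, fun v => ?_⟩
    simp [QuadraticMap.pi_apply]
  | succ k ih =>
    rw [pow_succ, mul_two]
    exact (ih.prod_smul one_ne_zero).of_equivalent (piAddIsometryEquiv _ Q)

/-- A Lagrangian of `Q` meets the kernel of every linear map into a space of less than
half the dimension. -/
theorem HasLagrangian.exists_mem_ker [FiniteDimensional K V] [FiniteDimensional K W]
    {Q : QuadraticForm K V} (h : HasLagrangian Q) (f : V →ₗ[K] W)
    (hf : 2 * Module.finrank K W < Module.finrank K V) : ∃ v, v ≠ 0 ∧ Q v = 0 ∧ f v = 0 := by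
  obtain ⟨U, hU, hd⟩ := h
  have hker : LinearMap.ker (f.comp U.subtype) ≠ ⊥ :=
    LinearMap.ker_ne_bot_of_finrank_lt (by omega)
  obtain ⟨v, hv, hv0⟩ := (Submodule.ne_bot_iff _).1 hker
  exact ⟨v, fun h0 => hv0 (Subtype.ext h0), hU v v.2, hv⟩

end QuadraticForm

/-! ### Similarity matrices with a prescribed first row -/

namespace QuadraticForm

open Matrix

variable {K : Type*} [Field K]

/-- Up to sign, two vectors of the same nonzero length are exchanged by a reflection. -/
theorem exists_orthogonal_vecMul_eq {ι : Type*} [Fintype ι] [DecidableEq ι] (h2 : (2 : K) ≠ 0)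
    {r a : ι → K} (hra : r ⬝ᵥ r = a ⬝ᵥ a) (ha : a ⬝ᵥ a ≠ 0) :
    ∃ H : Matrix ι ι K, Hᵀ * H = 1 ∧ (r ᵥ* H = a ∨ r ᵥ* H = -a) := by
  have key : ∀ b : ι → K, r ⬝ᵥ r = b ⬝ᵥ b → (r - b) ⬝ᵥ (r - b) ≠ 0 →
      ∃ H : Matrix ι ι K, Hᵀ * H = 1 ∧ r ᵥ* H = b := by
    intro b hb hw
    set w := r - b with hwdef
    set c : K := 2 / (w ⬝ᵥ w) with hc
    have hcw : c * (w ⬝ᵥ w) = 2 := by rw [hc]; field_simp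
    have hrw : 2 * (r ⬝ᵥ w) = w ⬝ᵥ w := by
      rw [hwdef]
      simp only [sub_dotProduct, dotProduct_sub, dotProduct_comm b r]
      linear_combination hb
    refine ⟨1 - c • vecMulVec w w, ?_, ?_⟩
    · have hT : (1 - c • vecMulVec w w)ᵀ = 1 - c • vecMulVec w w := by
        rw [transpose_sub, transpose_one, transpose_smul, transpose_vecMulVec]
      rw [hT, sub_mul, one_mul, mul_sub, mul_one, smul_mul_assoc, mul_smul_comm,
        vecMulVec_mul_vecMulVec, vecMulVec_smul, smul_smul c (w ⬝ᵥ w), hcw]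
      module
    · rw [vecMul_sub, vecMul_one, vecMul_smul, vecMul_vecMulVec, smul_smul]
      have : c * (r ⬝ᵥ w) = 1 := by
        apply mul_left_cancel₀ h2
        linear_combination c * hrw + hcw
      rw [this]
      simp [hwdef]
  by_cases hw : (r - a) ⬝ᵥ (r - a) = 0
  -- The lengths of `r - a` and `r + a` add up to `4 (a ⬝ᵥ a) ≠ 0`, so one of the two vectors
  -- defines a reflection.
  · have hw' : (r - -a) ⬝ᵥ (r - -a) ≠ 0 := by
      intro h0
      apply mul_ne_zero (mul_ne_zero h2 h2) ha
      simp only [sub_dotProduct, dotProduct_sub, dotProduct_neg, neg_dotProduct] at hw h0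
      linear_combination hw + h0 - 2 * hra
    obtain ⟨H, h1, h3⟩ := key (-a) (by simp [hra]) hw'
    exact ⟨H, h1, Or.inr h3⟩
  · obtain ⟨H, h1, h3⟩ := key a hra hw
    exact ⟨H, h1, Or.inl h3⟩

/-- A vector of nonzero length `s` in `K ^ (2 ^ k)` is, up to sign, the first row of a similarity
matrix of factor `s`. -/
theorem exists_similarity_row (h2 : (2 : K) ≠ 0) {m k : ℕ} (hm : m + 1 = 2 ^ k)
    {a : Fin (m + 1) → K} (ha : a ⬝ᵥ a ≠ 0) :
    ∃ M : Matrix (Fin (m + 1)) (Fin (m + 1)) K,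
      Mᵀ * M = (a ⬝ᵥ a) • (1 : Matrix (Fin (m + 1)) (Fin (m + 1)) K) ∧ (M 0 = a ∨ M 0 = -a) := by
  have hP : IsPfisterLike
      (QuadraticMap.pi fun _ : Fin (m + 1) => (QuadraticMap.sq (R := K))) := by
    rw [hm]
    exact isPfisterLike_sq.pi_two_pow k
  have hval : ∀ x : Fin (m + 1) → K,
      QuadraticMap.pi (fun _ : Fin (m + 1) => (QuadraticMap.sq (R := K))) x = x ⬝ᵥ x := by
    intro x
    simp [QuadraticMap.pi_apply, dotProduct]
  obtain ⟨S, hS⟩ := hP.round a (by rwa [hval])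
  simp only [hval] at hS
  set s := a ⬝ᵥ a with hs
  have hpol : ∀ x y, S x ⬝ᵥ S y = s * (x ⬝ᵥ y) := by
    intro x y
    have h := hS (x + y)
    simp only [map_add, add_dotProduct, dotProduct_add, hS, dotProduct_comm y x,
      dotProduct_comm (S y) (S x)] at h
    apply mul_left_cancel₀ h2
    linear_combination h
  set L := LinearMap.toMatrix' (S : (Fin (m + 1) → K) →ₗ[K] Fin (m + 1) → K) with hL
  have hLL : Lᵀ * L = s • (1 : Matrix (Fin (m + 1)) (Fin (m + 1)) K) := by
    ext i j
    have h := hpol (Pi.single i 1) (Pi.single j 1)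
    rw [mul_apply, Matrix.smul_apply, one_apply, smul_eq_mul]
    simp only [transpose_apply, hL, LinearMap.toMatrix'_apply]
    simp only [dotProduct, Pi.single_apply] at h
    simpa [dotProduct, eq_comm] using h
  have hLL' : L * Lᵀ = s • (1 : Matrix (Fin (m + 1)) (Fin (m + 1)) K) := by
    have h1 : (s⁻¹ • Lᵀ) * L = 1 := by
      rw [smul_mul_assoc, hLL, smul_smul, inv_mul_cancel₀ ha, one_smul]
    rw [mul_eq_one_comm, mul_smul_comm, inv_smul_eq_iff₀ ha] at h1
    exact h1
  have hr : L 0 ⬝ᵥ L 0 = s := by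
    have h := congrFun (congrFun hLL' 0) 0
    simpa [mul_apply, dotProduct] using h
  -- Roundness does not control the first row of `L`, only its length `s`, which is that of `a`.
  -- Multiplying on the right by an orthogonal matrix corrects the row and keeps the factor.
  obtain ⟨H, hH, hHa⟩ := exists_orthogonal_vecMul_eq h2 (hr.trans hs) ha
  refine ⟨L * H, ?_, ?_⟩
  · rw [transpose_mul, Matrix.mul_assoc, ← Matrix.mul_assoc Lᵀ, hLL, smul_mul_assoc, Matrix.one_mul,
      mul_smul_comm, hH]
  · exact hHa

theorem sum_bilin_mulVec {V ι : Type*} [AddCommGroup V] [Module K V] [Fintype ι] [DecidableEq ι]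
    (B : LinearMap.BilinForm K V) {M : Matrix ι ι K} {s : K} (hM : Mᵀ * M = s • (1 : Matrix ι ι K))
    (u : ι → V) :
    ∑ j, B (∑ i, M j i • u i) (∑ i, M j i • u i) = s * ∑ i, B (u i) (u i) := by
  have h : ∀ i i', ∑ j, M j i * M j i' = if i = i' then s else 0 := by
    intro i i'
    have := congrFun (congrFun hM i) i'
    simpa [mul_apply, one_apply] using this
  calc _ = ∑ j, ∑ i, ∑ i', M j i * M j i' * B (u i') (u i) := by
        simp [map_sum, LinearMap.sum_apply, mul_assoc, Finset.mul_sum]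
    _ = ∑ i, ∑ i', (∑ j, M j i * M j i') * B (u i') (u i) := by
        rw [Finset.sum_comm]
        refine Finset.sum_congr rfl fun i _ => ?_
        rw [Finset.sum_comm]
        simp only [Finset.sum_mul]
    _ = _ := by simp [h, Finset.mul_sum]

/-- If `∑ aᵢ uᵢ = 0` and `s = ∑ aᵢ² ≠ 0`, with `2 ^ k` terms, then `s ∑ Q(uᵢ)` is represented by
`(2 ^ k - 1) × Q`. -/
theorem exists_sum_eq_of_sum_smul_eq_zero {V : Type*} [AddCommGroup V] [Module K V]
    (h2 : (2 : K) ≠ 0) {m k : ℕ} (hm : m + 1 = 2 ^ k) (B : LinearMap.BilinForm K V)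
    {a : Fin (m + 1) → K} (ha : a ⬝ᵥ a ≠ 0) {u : Fin (m + 1) → V} (hu : ∑ i, a i • u i = 0) :
    ∃ v : Fin m → V, ∑ j, B (v j) (v j) = (a ⬝ᵥ a) * ∑ i, B (u i) (u i) := by
  obtain ⟨M, hM, h0⟩ := exists_similarity_row h2 hm ha
  refine ⟨fun j => ∑ i, M j.succ i • u i, ?_⟩
  rw [← sum_bilin_mulVec B hM u, Fin.sum_univ_succ]
  have hz : ∑ i, M 0 i • u i = 0 := by
    rcases h0 with h0 | h0
    · rw [h0, hu]
    · rw [h0]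
      simp [hu]
  rw [hz, map_zero, zero_add]

end QuadraticForm

/-! ### Norm and trace forms of Cayley–Dickson algebras -/

namespace ScalarInvolutionAlgebra
open QuadraticForm

variable {K : Type u} [Field K]

theorem pureTraceForm_apply (A : ScalarInvolutionAlgebra K) (x : A.pure) :
    A.pureTraceForm x = 2⁻¹ * A.trace ((x : A) * (x : A)) := rfl

/-- The norm as a quadratic form. -/
def normForm (A : ScalarInvolutionAlgebra K) : QuadraticForm K A :=
  (2 : K)⁻¹ • QuadraticMap.linMulLin A.trace A.trace - A.traceForm

/-- Take the trace of `x² = t(x) x - n(x)`. The condition `t(1) = 2` rules out the zero algebra,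
where `norm` is arbitrary. -/
theorem normForm_apply (h2 : (2 : K) ≠ 0) {A : ScalarInvolutionAlgebra K}
    (h1 : A.trace (1 : A) = 2) (x : A) : A.normForm x = A.norm x := by
  change 2⁻¹ * (A.trace x * A.trace x) - 2⁻¹ * A.trace (x * x) = _
  rw [A.mul_self_eq, map_sub, map_smul, map_smul, h1, smul_eq_mul, smul_eq_mul]
  field_simp
  ring

theorem traceForm_eq_sub (h2 : (2 : K) ≠ 0) {A : ScalarInvolutionAlgebra K}
    (h1 : A.trace (1 : A) = 2) (x : A) :
    A.traceForm x = 2⁻¹ * (A.trace x * A.trace x) - A.norm x := by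
  rw [← normForm_apply h2 h1]
  change _ = 2⁻¹ * (A.trace x * A.trace x) - (2⁻¹ * (A.trace x * A.trace x) - A.traceForm x)
  ring

theorem trace_star {A : ScalarInvolutionAlgebra K}
    (h1 : A.trace (1 : A) = 2) (x : A) : A.trace (star x) = A.trace x := by
  have h : star x = A.trace x • (1 : A) - x := by rw [A.trace_smul_one]; abel
  rw [h, map_sub, map_smul, h1, smul_eq_mul]
  ring

theorem trace_cayleyDickson_one (t : ℕ) (α : Fin t → K) :
    (cayleyDickson t α).trace (1 : cayleyDickson t α) = 2 := by
  induction t with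
  | zero => exact mul_one _
  | succ t ih => exact ih _

/-- The double of `A` is `A × A` as a vector space. -/
def doubleEquiv (A : ScalarInvolutionAlgebra K) (γ : K) : (A × A) ≃ₗ[K] A.double γ where
  toFun x := x
  invFun x := x
  map_add' _ _ := rfl
  map_smul' _ _ := rfl
  left_inv _ := rfl
  right_inv _ := rfl

theorem finiteDimensional_cayleyDickson (t : ℕ) (α : Fin t → K) :
    FiniteDimensional K (cayleyDickson t α) := by
  induction t with
  | zero => exact inferInstanceAs (FiniteDimensional K K)
  | succ t ih =>
    have := ih (fun i => α i.castSucc)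
    exact (doubleEquiv (cayleyDickson t fun i => α i.castSucc) (α (Fin.last t))).finiteDimensional

theorem finrank_cayleyDickson (t : ℕ) (α : Fin t → K) :
    Module.finrank K (cayleyDickson t α) = 2 ^ t := by
  induction t with
  | zero => exact Module.finrank_self K
  | succ t ih =>
    have := finiteDimensional_cayleyDickson t (fun i => α i.castSucc)
    rw [pow_succ, mul_two]
    refine (doubleEquiv (cayleyDickson t fun i => α i.castSucc)
      (α (Fin.last t))).finrank_eq.symm.trans ?_
    rw [Module.finrank_prod, ih]

/-- Each doubling replaces the norm form `n` by `n ⊥ (-γ) n`, starting from `⟨1⟩`. -/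
theorem isPfisterLike_normForm (h2 : (2 : K) ≠ 0) (t : ℕ) (α : Fin t → K) (hα : ∀ i, α i ≠ 0) :
    IsPfisterLike (cayleyDickson t α).normForm := by
  induction t with
  | zero =>
    refine isPfisterLike_sq.of_equivalent ⟨LinearEquiv.refl K K, fun v => ?_⟩
    exact normForm_apply h2 (trace_cayleyDickson_one 0 α) v
  | succ t ih =>
    have := finiteDimensional_cayleyDickson t (fun i => α i.castSucc)
    refine ((ih (fun i => α i.castSucc) fun i => hα _).prod_smul
      (neg_ne_zero.2 (hα (Fin.last t)))).of_equivalent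
      ⟨doubleEquiv _ _, fun v => ?_⟩
    refine (normForm_apply h2 (trace_cayleyDickson_one (t + 1) α) _).trans ?_
    change norm _ v.1 - α (Fin.last t) * norm _ v.2 = _
    rw [QuadraticMap.prod_apply, _root_.smul_apply, normForm_apply h2 (trace_cayleyDickson_one t _),
      normForm_apply h2 (trace_cayleyDickson_one t _), smul_eq_mul]
    ring

/-- The trace form is nondegenerate. -/
theorem exists_trace_mul_ne_zero (h2 : (2 : K) ≠ 0) (t : ℕ) (α : Fin t → K) (hα : ∀ i, α i ≠ 0)
    (x : cayleyDickson t α) (hx : x ≠ 0) :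
    ∃ y, (cayleyDickson t α).trace (x * y) ≠ 0 := by
  induction t with
  | zero =>
    refine ⟨(1 : K), ?_⟩
    change (2 : K) * ((show K from x) * 1) ≠ 0
    rw [mul_one]
    exact mul_ne_zero h2 hx
  | succ t ih =>
    set A := cayleyDickson t (fun i => α i.castSucc) with hA
    have h1 : A.trace (1 : A) = 2 := trace_cayleyDickson_one t _
    obtain ⟨x₁, x₂⟩ := x
    have htr : ∀ y₁ y₂ : A, (cayleyDickson (t + 1) α).trace
        ((show cayleyDickson (t + 1) α from (x₁, x₂)) * (show cayleyDickson (t + 1) α from (y₁, y₂)))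
        = A.trace (x₁ * y₁) + α (Fin.last t) * A.trace (star y₂ * x₂) := by
      intro y₁ y₂
      change A.trace (x₁ * y₁ + α (Fin.last t) • (star y₂ * x₂)) = _
      rw [map_add, map_smul, smul_eq_mul]
    -- A nonzero `x₁` is detected by `(y, 0)`. If `x₁ = 0`, then `(0, y)` gives `γ t(ȳ x₂) = γ t(x̄₂
    -- y)`, so induction is applied to `x̄₂`.
    rcases eq_or_ne x₁ 0 with h0 | h0
    · have hx₂ : star x₂ ≠ 0 := by
        intro h
        apply hx
        rw [star_eq_zero] at h
        rw [h0, h]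
        rfl
      obtain ⟨y, hy⟩ := ih (fun i => α i.castSucc) (fun i => hα _) (star x₂) hx₂
      refine ⟨((0 : A), y), ?_⟩
      refine (htr 0 y).trans_ne ?_
      rw [mul_zero, map_zero, zero_add, ← trace_star h1, star_mul, star_star]
      exact mul_ne_zero (hα _) hy
    · obtain ⟨y, hy⟩ := ih (fun i => α i.castSucc) (fun i => hα _) x₁ h0
      refine ⟨(y, (0 : A)), ?_⟩
      refine (htr y 0).trans_ne ?_
      rw [star_zero, zero_mul, map_zero, mul_zero, add_zero]
      exact hy

end ScalarInvolutionAlgebra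

/-! ### The sublevel with zero squares allowed -/

/-- Pad a shorter relation with zeros, or discard the zero squares. This form fixes the length at `m
+ 1`, as needed for arguments with exactly `2 ^ k` terms. -/
theorem sublevel_le_iff {A : Type*} [NonAssocRing A] (m : ℕ) :
    sublevel A ≤ (m : ℕ∞) ↔
      ∃ y : Fin (m + 1) → A, (∃ i, y i * y i ≠ 0) ∧ ∑ i, y i * y i = 0 := by
  classical
  constructor
  · intro h
    have : ∃ n : ℕ, n ≤ m ∧
        ∃ y : Fin (n + 1) → A, (∀ i, y i * y i ≠ 0) ∧ ∑ i, y i * y i = 0 := by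
      by_contra hc
      push Not at hc
      have h' : ((m + 1 : ℕ) : ℕ∞) ≤ sublevel A := by
        refine le_iInf₂ fun n hn => ?_
        obtain ⟨y, hy, hy0⟩ := hn
        by_contra hlt
        rw [Nat.cast_le] at hlt
        exact hc n (by omega) y hy hy0
      have := h'.trans h
      rw [Nat.cast_le] at this
      omega
    obtain ⟨n, hn, y, hy, hy0⟩ := this
    obtain ⟨d, rfl⟩ := Nat.exists_eq_add_of_le hn
    have he : n + 1 + d = n + d + 1 := by omega
    rw [← he]
    refine ⟨Fin.append y 0, ⟨Fin.castAdd d 0, ?_⟩, ?_⟩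
    · rw [Fin.append_left]
      exact hy 0
    · rw [Fin.sum_univ_add]
      simp [hy0]
  · rintro ⟨y, ⟨i₀, hi₀⟩, h0⟩
    set s := Finset.univ.filter fun i => y i * y i ≠ 0 with hs
    have hpos : 0 < s.card := Finset.card_pos.2 ⟨i₀, by simp [hs, hi₀]⟩
    have hle : s.card ≤ m + 1 := by simpa using s.card_le_univ
    obtain ⟨n, hn⟩ := Nat.exists_eq_succ_of_ne_zero hpos.ne'
    let e : Fin (n + 1) ≃ s := (s.equivFinOfCardEq hn).symm
    have hsum : ∑ j, y (e j) * y (e j) = 0 := by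
      rw [e.sum_comp (fun j : s => y j * y j), Finset.sum_coe_sort s fun i => y i * y i, hs,
        Finset.sum_filter_ne_zero]
      exact h0
    have hne : ∀ j, y (e j) * y (e j) ≠ 0 := fun j => (Finset.mem_filter.1 (e j).2).2
    refine (iInf₂_le n ⟨fun j => y (e j), hne, hsum⟩).trans ?_
    · rw [Nat.cast_le]
      omega

theorem QuadraticForm.onePerpCopies_apply {K V : Type*} [Field K] [AddCommGroup V] [Module K V]
    (n : ℕ) (Q : QuadraticForm K V) (x : K × (Fin n → V)) :
    QuadraticForm.onePerpCopies n Q x = x.1 * x.1 + ∑ i, Q (x.2 i) := by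
  simp [QuadraticForm.onePerpCopies]

/-! ### Scalar and pure parts; the degenerate cases -/

namespace ScalarInvolutionAlgebra
open QuadraticForm

variable {K : Type u} [Field K]

theorem pureTraceForm_eq_neg_norm (h2 : (2 : K) ≠ 0) {A : ScalarInvolutionAlgebra K}
    (h1 : A.trace (1 : A) = 2) (x : A.pure) : A.pureTraceForm x = -A.norm (x : A) := by
  have hx : A.trace (x : A) = 0 := x.2
  refine (traceForm_eq_sub h2 h1 (x : A)).trans ?_
  rw [hx, mul_zero, mul_zero, zero_sub]

theorem pure_mul_self (h2 : (2 : K) ≠ 0) {A : ScalarInvolutionAlgebra K}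
    (h1 : A.trace (1 : A) = 2) (x : A.pure) :
    (x : A) * (x : A) = A.pureTraceForm x • (1 : A) := by
  have hx : A.trace (x : A) = 0 := x.2
  rw [pureTraceForm_eq_neg_norm h2 h1, A.mul_self_eq, hx, zero_smul, zero_sub, neg_smul]

theorem sub_trace_smul_one_mem_pure (h2 : (2 : K) ≠ 0) {A : ScalarInvolutionAlgebra K}
    (h1 : A.trace (1 : A) = 2) (x : A) : x - (2⁻¹ * A.trace x) • (1 : A) ∈ A.pure := by
  change A.trace _ = 0
  rw [map_sub, map_smul, h1, smul_eq_mul]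
  field_simp
  ring

/-- A family with `∑ yᵢ² = 0` splits as `yᵢ = aᵢ + uᵢ` with `uᵢ` pure, `∑ aᵢ uᵢ = 0` and
`∑ (aᵢ² + T_P(uᵢ)) = 0`. -/
theorem exists_scalar_add_pure (h2 : (2 : K) ≠ 0) {A : ScalarInvolutionAlgebra K}
    (h1 : A.trace (1 : A) = 2) {n : ℕ} {y : Fin n → A} (hy : ∑ i, y i * y i = 0) :
    ∃ (a : Fin n → K) (u : Fin n → A.pure), (∀ i, y i = a i • (1 : A) + u i) ∧
      ∑ i, a i • u i = 0 ∧ ∑ i, a i * a i + ∑ i, A.pureTraceForm (u i) = 0 := by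
  let a : Fin n → K := fun i => 2⁻¹ * A.trace (y i)
  let u : Fin n → A.pure := fun i => ⟨y i - a i • (1 : A), sub_trace_smul_one_mem_pure h2 h1 (y i)⟩
  have hyu : ∀ i, y i = a i • (1 : A) + u i := fun i => by simp [u]
  have hsq : ∀ i, y i * y i =
      (2 : K) • (a i • (u i : A)) + (a i * a i + A.pureTraceForm (u i)) • (1 : A) := by
    intro i
    rw [hyu i, mul_add, add_mul, add_mul, pure_mul_self h2 h1, smul_mul_assoc, one_mul,
      smul_mul_assoc, one_mul, mul_smul_comm, mul_one]
    module
  have hs : (2 : K) • ∑ i, a i • (u i : A) +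
      (∑ i, a i * a i + ∑ i, A.pureTraceForm (u i)) • (1 : A) = 0 := by
    rw [← hy, Finset.smul_sum, ← Finset.sum_add_distrib, Finset.sum_smul, ← Finset.sum_add_distrib]
    exact (Finset.sum_congr rfl fun i _ => hsq i).symm
  have hp : A.trace (∑ i, a i • (u i : A)) = 0 := by
    rw [map_sum]
    refine Finset.sum_eq_zero fun i _ => ?_
    have : A.trace (u i : A) = 0 := (u i).2
    rw [map_smul, this, smul_zero]
  have hscal : ∑ i, a i * a i + ∑ i, A.pureTraceForm (u i) = 0 := by
    have h := congrArg A.trace hs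
    rw [map_add, map_smul, map_smul, hp, h1, map_zero, smul_zero, zero_add, smul_eq_mul] at h
    exact (mul_eq_zero.1 h).resolve_right h2
  refine ⟨a, u, hyu, ?_, hscal⟩
  rw [hscal, zero_smul, add_zero] at hs
  apply Subtype.ext
  simpa using (smul_eq_zero.1 hs).resolve_left h2

theorem exists_pure_ne_zero {A : ScalarInvolutionAlgebra K} [FiniteDimensional K A]
    (hA : 1 < Module.finrank K A) : ∃ x : A.pure, x ≠ 0 := by
  have hker : LinearMap.ker A.trace ≠ ⊥ :=
    LinearMap.ker_ne_bot_of_finrank_lt (by rwa [Module.finrank_self])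
  obtain ⟨v, hv, hv0⟩ := (Submodule.ne_bot_iff _).1 hker
  exact ⟨⟨v, hv⟩, fun h => hv0 (congrArg Subtype.val h)⟩

/-- If `∑ aᵢ² = 0` has a nontrivial solution of length `2 ^ k`, then `(2 ^ k - 1) × Q` is isotropic
for every form `Q` on a nonzero space. -/
theorem isIsotropic_pi_of_sum_sq_eq_zero {V : Type*} [AddCommGroup V] [Module K V]
    (Q : QuadraticForm K V) {w : V} (hw : w ≠ 0) {m k : ℕ} (hm : m + 1 = 2 ^ k) (hm2 : 2 ≤ m)
    {a : Fin (m + 1) → K} (ha : a ≠ 0) (hs : ∑ i, a i * a i = 0) :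
    ∃ v : Fin m → V, v ≠ 0 ∧ ∑ i, Q (v i) = 0 := by
  have hP : IsPfisterLike
      (QuadraticMap.pi fun _ : Fin (m + 1) => (QuadraticMap.sq (R := K))) := by
    rw [hm]
    exact isPfisterLike_sq.pi_two_pow k
  -- One linear condition, `x₀ = 0`, can be imposed because `2 < 2 ^ k`.
  obtain ⟨x, hx, hx0, hxf⟩ := (hP.hasLagrangian ⟨a, ha, by simpa using hs⟩).exists_mem_ker
    (LinearMap.proj 0 : (Fin (m + 1) → K) →ₗ[K] K) (by simp; omega)
  have hxf' : x 0 = 0 := hxf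
  refine ⟨fun i => x i.succ • w, fun h => hx ?_, ?_⟩
  · refine funext fun i => Fin.cases hxf' (fun j => ?_) i
    exact (smul_eq_zero.1 (congrFun h j)).resolve_right hw
  · simp only [QuadraticMap.pi_apply, QuadraticMap.sq_apply, Fin.sum_univ_succ, hxf', mul_zero,
      zero_add] at hx0
    simp only [QuadraticMap.map_smul, smul_eq_mul]
    rw [← Finset.sum_mul, hx0, zero_mul]

/-- If `2 ^ k` copies of the norm form are isotropic, then so are `2 ^ k - 1` copies of the pure
trace form. -/
theorem exists_sum_pureTraceForm_eq_zero (h2 : (2 : K) ≠ 0) {A : ScalarInvolutionAlgebra K}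
    [FiniteDimensional K A] (h1 : A.trace (1 : A) = 2) (hA : IsPfisterLike A.normForm)
    (hdim : 4 ≤ Module.finrank K A) {m k : ℕ} (hm : m + 1 = 2 ^ k) (hm3 : 3 ≤ m)
    {y : Fin (m + 1) → A} (hy : y ≠ 0) (hs : ∑ i, A.norm (y i) = 0) :
    ∃ v : Fin m → A.pure, v ≠ 0 ∧ ∑ i, A.pureTraceForm (v i) = 0 := by
  have hP : IsPfisterLike (QuadraticMap.pi fun _ : Fin (m + 1) => A.normForm) := by
    rw [hm]
    exact hA.pi_two_pow k
  -- The kernel consists of families whose first entry is zero and whose others are pure. With `N =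
  -- dim A`, the count needed is `2 (N + m) < (m + 1) N`, which holds for `N ≥ 4` and `m ≥ 3`.
  let f : (Fin (m + 1) → A) →ₗ[K] A × (Fin m → K) :=
    (LinearMap.proj 0).prod (LinearMap.pi fun i : Fin m => A.trace.comp (LinearMap.proj i.succ))
  obtain ⟨x, hx, hx0, hxf⟩ := (hP.hasLagrangian ⟨y, hy, by
    simpa [normForm_apply h2 h1] using hs⟩).exists_mem_ker f (by
      rw [Module.finrank_prod, Module.finrank_fin_fun, Module.finrank_pi_fintype]
      simp only [Finset.sum_const, Finset.card_univ, Fintype.card_fin, smul_eq_mul]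
      nlinarith)
  have hx00 : x 0 = 0 := congrArg Prod.fst hxf
  have hxp : ∀ i : Fin m, A.trace (x i.succ) = 0 := fun i => congrFun (congrArg Prod.snd hxf) i
  refine ⟨fun i => ⟨x i.succ, hxp i⟩, fun h => hx ?_, ?_⟩
  · refine funext fun i => Fin.cases hx00 (fun j => ?_) i
    exact congrArg Subtype.val (congrFun h j)
  · rw [QuadraticMap.pi_apply, Fin.sum_univ_succ, hx00, QuadraticMap.map_zero, zero_add] at hx0
    simp only [normForm_apply h2 h1] at hx0
    simp only [pureTraceForm_eq_neg_norm h2 h1, Finset.sum_neg_distrib, hx0, neg_zero]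

/-- An isotropic pure trace form represents `-1`. -/
theorem exists_pureTraceForm_eq_neg_one (h2 : (2 : K) ≠ 0) {A : ScalarInvolutionAlgebra K}
    (h1 : A.trace (1 : A) = 2) (hA : ∀ x : A, x ≠ 0 → ∃ y, A.trace (x * y) ≠ 0)
    {u : A.pure} (hu : u ≠ 0) (h0 : A.pureTraceForm u = 0) :
    ∃ w : A.pure, A.pureTraceForm w = -1 := by
  have hut : A.trace (u : A) = 0 := u.2
  obtain ⟨y, hy⟩ := hA u fun h => hu (Subtype.ext h)
  -- Removing the scalar part of `y` does not change `t(u y)`, because `t(u) = 0`.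
  obtain ⟨w, hw⟩ : ∃ w : A.pure, A.trace ((u : A) * w) ≠ 0 := by
    refine ⟨⟨y - (2⁻¹ * A.trace y) • (1 : A), sub_trace_smul_one_mem_pure h2 h1 y⟩, ?_⟩
    rw [mul_sub, mul_smul_comm, mul_one, map_sub, map_smul, hut, smul_zero, sub_zero]
    exact hy
  have hcomm : A.trace ((w : A) * u) = A.trace ((u : A) * w) := by
    have hst : ∀ x : A.pure, star (x : A) = -(x : A) := fun x => by
      have h := A.trace_smul_one (x : A)
      have hx : A.trace (x : A) = 0 := x.2
      rw [hx, zero_smul] at h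
      exact (neg_eq_of_add_eq_zero_right h.symm).symm
    rw [← trace_star h1, star_mul, hst, hst, neg_mul_neg]
  set b := A.trace ((u : A) * w)
  -- As `u` is isotropic, the form is affine in `c` along this line with slope `b ≠ 0`, so it takes
  -- every value.
  have hval : ∀ c : K, A.pureTraceForm (w + c • u) = A.pureTraceForm w + c * b := by
    intro c
    have hu0 : A.trace ((u : A) * u) = 0 := by
      rw [pureTraceForm_apply] at h0
      exact (mul_eq_zero.1 h0).resolve_left (inv_ne_zero h2)
    rw [pureTraceForm_apply, pureTraceForm_apply, Submodule.coe_add, Submodule.coe_smul, mul_add,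
      add_mul, add_mul, smul_mul_assoc, smul_mul_assoc, mul_smul_comm, mul_smul_comm]
    simp only [map_add, map_smul, smul_eq_mul, hu0, hcomm]
    rw [show A.trace ((u : A) * w) = b from rfl]
    field_simp
    ring
  refine ⟨w + ((-1 - A.pureTraceForm w) / b) • u, ?_⟩
  rw [hval]
  field_simp
  ring

end ScalarInvolutionAlgebra

/-! ### The equivalence -/

open ScalarInvolutionAlgebra QuadraticForm in
theorem proposition3p5 {K : Type u} [Field K] (hK : ringChar K ≠ 2)
    (t : ℕ) (ht : 2 ≤ t) (α : Fin t → K) (hα : ∀ i, α i ≠ 0) (k : ℕ) (hk : 1 < k) :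
    sublevel (ScalarInvolutionAlgebra.cayleyDickson t α) ≤ ((2 ^ k - 1 : ℕ) : ℕ∞) ↔
      (QuadraticForm.onePerpCopies (2 ^ k - 1)
        (ScalarInvolutionAlgebra.cayleyDickson t α).pureTraceForm).IsIsotropic := by
  have h2 : (2 : K) ≠ 0 := Ring.two_ne_zero hK
  have h1 := trace_cayleyDickson_one t α
  have hPf := isPfisterLike_normForm h2 t α hα
  have hnd := exists_trace_mul_ne_zero h2 t α hα
  have hfin := finiteDimensional_cayleyDickson t α
  have hdim : 4 ≤ Module.finrank K (cayleyDickson t α) := by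
    rw [finrank_cayleyDickson]
    calc 4 = 2 ^ 2 := rfl
      _ ≤ 2 ^ t := Nat.pow_le_pow_right two_pos ht
  have hk4 : 4 ≤ 2 ^ k := by
    calc 4 = 2 ^ 2 := rfl
      _ ≤ 2 ^ k := Nat.pow_le_pow_right two_pos hk
  obtain ⟨m, hm⟩ : ∃ m, m + 1 = 2 ^ k := ⟨2 ^ k - 1, by omega⟩
  rw [← hm] at hk4 ⊢
  rw [Nat.add_sub_cancel, sublevel_le_iff]
  -- From here on only the collected facts matter: `t(1) = 2`, the Pfister properties of the norm,
  -- nondegeneracy, and dimension at least 4.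
  generalize cayleyDickson t α = A at *
  constructor
  · rintro ⟨y, ⟨i₀, hi₀⟩, hy⟩
    have hiso : (∃ v : Fin m → A.pure, v ≠ 0 ∧ ∑ i, A.pureTraceForm (v i) = 0) →
        (onePerpCopies m A.pureTraceForm).IsIsotropic := by
      rintro ⟨v, hv, hv0⟩
      exact ⟨(0, v), fun h => hv (congrArg Prod.snd h), by simp [onePerpCopies_apply, hv0]⟩
    obtain ⟨a, u, hyu, hau, hs⟩ := exists_scalar_add_pure h2 h1 hy
    rcases eq_or_ne (∑ i, a i * a i) 0 with ha | ha
    · apply hiso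
      rcases eq_or_ne a 0 with rfl | ha0
      · have hyu' : ∀ i, y i = u i := fun i => by simpa using hyu i
        refine exists_sum_pureTraceForm_eq_zero h2 h1 hPf hdim hm (by omega) (y := y) ?_ ?_
        · intro h
          apply hi₀
          rw [h]
          exact mul_zero _
        · rw [ha, zero_add] at hs
          simp only [pureTraceForm_eq_neg_norm h2 h1, Finset.sum_neg_distrib, neg_eq_zero] at hs
          simpa only [hyu'] using hs
      · obtain ⟨w, hw⟩ := exists_pure_ne_zero (A := A) (by omega)
        exact isIsotropic_pi_of_sum_sq_eq_zero A.pureTraceForm hw hm (by omega) ha0 ha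
    · obtain ⟨v, hv⟩ := exists_sum_eq_of_sum_smul_eq_zero h2 hm
        (((LinearMap.mul K A).compr₂ ((2 : K)⁻¹ • A.trace)).domRestrict₁₂ A.pure A.pure) ha hau
      replace hv : ∑ j, A.pureTraceForm (v j) =
        (∑ i, a i * a i) * ∑ i, A.pureTraceForm (u i) := hv
      refine ⟨(∑ i, a i * a i, v), fun h => ha (congrArg Prod.fst h), ?_⟩
      -- With `s = ∑ aᵢ²`, the value at `(s, v)` is `s (s + ∑ T_P(uᵢ)) = 0`.
      rw [onePerpCopies_apply, hv, ← mul_add, hs, mul_zero]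
  · rintro ⟨⟨a, v⟩, hav, h0⟩
    rw [onePerpCopies_apply] at h0
    have h11 : (1 : A) ≠ 0 := by
      intro h
      rw [h, map_zero] at h1
      exact h2 h1.symm
    -- In this case every square in the evident relation is zero, so the relation `1² + w² = 0` is
    -- used instead, padded with zeros.
    by_cases hall : a = 0 ∧ ∀ i, A.pureTraceForm (v i) = 0
    · obtain ⟨ha, hv⟩ := hall
      obtain ⟨i, hi⟩ : ∃ i, v i ≠ 0 := by
        by_contra! hc
        exact hav (Prod.ext ha (funext hc))
      obtain ⟨w, hw⟩ := exists_pureTraceForm_eq_neg_one h2 h1 hnd hi (hv i)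
      obtain ⟨d, rfl⟩ : ∃ d, m = d + 1 := ⟨m - 1, by omega⟩
      refine ⟨Fin.cons (1 : A) (Fin.cons (w : A) 0), ⟨0, by simpa using h11⟩, ?_⟩
      rw [Fin.sum_univ_succ, Fin.sum_univ_succ]
      simp [pure_mul_self h2 h1, hw]
    · refine ⟨Fin.cons (a • (1 : A)) fun i => (v i : A), ?_, ?_⟩
      · rw [not_and_or, not_forall] at hall
        rcases hall with ha | ⟨i, hi⟩
        · refine ⟨0, ?_⟩
          simp [ha, h11]
        · refine ⟨i.succ, ?_⟩
          simp [pure_mul_self h2 h1, hi, h11]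
      · rw [Fin.sum_univ_succ]
        simp only [Fin.cons_zero, Fin.cons_succ, pure_mul_self h2 h1]
        rw [← Finset.sum_smul, smul_mul_assoc, one_mul, smul_smul, ← add_smul, h0, zero_smul]
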